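/- Let $D=\{(x,y)\in\mathbb R^2 : x^2+y^2<1\}$, with boundary circle $S^1$. **Circle map and rotation number.** For a compact convex non-empty set $U\subset D$ and $v\in S^1$, let $\psi_U(v)$ be the point of $S^1$ closest to $v$ in the counterclockwise direction among the points $w\in S^1\setminus\{v\}$ such that the line $vw$ is tangent to (supports) $U$. Equivalently, let $R(v)$ be $v$ rotated by $+90^\circ$ and let $\theta(v)$ be the minimum over $u\in U$ of the gradient $b/a$ of the line $uv$, where $u-v=a\,v+b\,R(v)$; then $\psi_U(v)$ is the second intersection with $S^1$ of the line through $v$ of gradient $\theta(v)$ in the basis $\{v,R(v)\}$. For an orientation preserving homeomorphism $f$ of $S^1\cong\mathbb R/\mathbb Z$ put $\rho(f)=\lim_{n\to\infty}\frac{\bar f^{\,n}(x)-x}{n}$, where $\bar f:\mathbb R\to\mathbb R$ is the lift of $f$ with $\bar f(0)\in[0,1)$ (the limit exists and does not depend on $x\in\mathbb R$). **Distances.** For distinct $P,Q\in D$ let $v_1,v_2\in S^1$ be the two points in which the line $PQ$ meets $S^1$, and put $$d'(P,Q)=\frac12\left|\log\frac{|v_1Q|\,|v_2P|}{|v_1P|\,|v_2Q|}\right|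 ,\qquad d'(P,P)=0 .$$ For distinct $P,Q\in D$ and $R\in D$ put $$\Delta_2'(P,Q)=\log\frac{e^{2d'(P,Q)}+1}{e^{2d'(P,Q)}-1},\qquad \delta(P,Q,R)=\min\{d'(R,S) : S\in D \text{ on the line } PQ\}.$$ **Theorem.** Let $P_1,P_2,P_3\in D$ be the vertices of a (non-degenerate) triangle, and let $\triangle P_1P_2P_3$ be their convex hull. Suppose that $\Delta_2'(P_i,P_j)>\delta(P_i,P_j,P_k)$ for all $i,j,k$ with $\{i,j,k\}=\{1,2,3\}$. Then $\psi_{\triangle P_1P_2P_3}$ is an orientation preserving homeomorphism of $S^1$ and $$\rho(\psi_{\triangle P_1P_2P_3})>\frac25 .$$ -/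

import Mathlib

namespace BarBilliard

noncomputable section

/-! The plane is identified with `ℂ`; the disk `D` is `{z | ‖z‖ < 1}` and its boundary `S¹` is
Mathlib's `Circle`. -/

/-! ### The circle map of a convex set -/

/-- For `v` on the unit circle, the gradient of the line `uv` in the coordinates given by the basis
`{v, R v}`, where `R v = I * v` is `v` turned by a right angle: if `u - v = a • v + b • R v`,
it is `b / a`. (One has `a < 0` for `u` in the disk.) -/
def gradient (v u : ℂ) : ℝ := ((u - v) / v).im / ((u - v) / v).re

/-- The least gradient of a line joining `v` to a point of `U`
(a minimum when `U` is non-empty and compact in the open disk). -/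
def minGradient (U : Set ℂ) (v : Circle) : ℝ := sInf ((fun u => gradient v u) '' U)

/-- The map `ψ_U`: the image of `v` is the second intersection point of the circle with the line
through `v` of gradient `minGradient U v`; see `psi_eq_iff`. -/
def psi (U : Set ℂ) (v : Circle) : Circle :=
  v * Circle.exp (Real.pi + 2 * Real.arctan (minGradient U v))

theorem gradient_mul_exp (v : Circle) {a : ℝ} (h1 : -(Real.pi / 2) < a) (h2 : a < Real.pi / 2) :
    gradient v (v * Circle.exp (Real.pi + 2 * a) : Circle) = Real.tan a := by
  have hc : 0 < Real.cos a := Real.cos_pos_of_mem_Ioo ⟨h1, h2⟩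
  have hv : (v : ℂ) ≠ 0 := v.coe_ne_zero
  have key : (((v * Circle.exp (Real.pi + 2 * a) : Circle) : ℂ) - v) / v
      = Complex.exp ((Real.pi + 2 * a : ℝ) * Complex.I) - 1 := by
    rw [Circle.coe_mul, Circle.coe_exp]; field_simp
  rw [gradient, key, Complex.sub_im, Complex.sub_re, Complex.exp_ofReal_mul_I_re,
    Complex.exp_ofReal_mul_I_im, Real.tan_eq_sin_div_cos, add_comm, Real.cos_add_pi,
    Real.sin_add_pi, Real.sin_two_mul, Real.cos_two_mul]
  simp only [Complex.one_re, Complex.one_im]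
  have : -(2 * Real.cos a ^ 2 - 1) - 1 ≠ 0 := by nlinarith [pow_pos hc 2]
  field_simp
  ring

/-- `ψ_U v` is the point of the circle other than `v` on the line through `v` of gradient
`minGradient U v`. -/
theorem psi_eq_iff (U : Set ℂ) (v w : Circle) :
    psi U v = w ↔ w ≠ v ∧ gradient v w = minGradient U v := by
  constructor
  · rintro rfl
    refine ⟨fun h => ?_, ?_⟩
    · rw [psi, mul_eq_left] at h
      have h2 := congrArg (fun z : Circle => (z : ℂ).re) h
      simp only [Circle.coe_exp, Complex.exp_ofReal_mul_I_re, Circle.coe_one, Complex.one_re] at h2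
      rw [add_comm, Real.cos_add_pi, Real.cos_two_mul] at h2
      nlinarith [pow_pos (Real.cos_arctan_pos (minGradient U v)) 2]
    · rw [psi, gradient_mul_exp v (Real.neg_pi_div_two_lt_arctan _) (Real.arctan_lt_pi_div_two _),
        Real.tan_arctan]
  · rintro ⟨hne, hg⟩
    set a := Complex.arg ((-(w / v) : Circle) : ℂ) / 2 with ha
    have hw : w = v * Circle.exp (Real.pi + 2 * a) := by
      have : Circle.exp (2 * a) = -(w / v) := by
        rw [ha, mul_div_cancel₀ _ (two_ne_zero)]; exact Circle.exp_arg _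
      rw [Circle.exp_add, this]
      ext1
      simp [mul_div_cancel₀ _ v.coe_ne_zero]
    have h1 : -(Real.pi / 2) < a := by
      have := Complex.neg_pi_lt_arg ((-(w / v) : Circle) : ℂ); linarith
    have h2 : a < Real.pi / 2 := by
      have h3 := Complex.arg_le_pi ((-(w / v) : Circle) : ℂ)
      rcases h3.lt_or_eq with h3 | h3
      · linarith
      · exfalso
        apply hne
        rw [hw, ha, h3, mul_div_cancel₀ _ (two_ne_zero), ← two_mul, Circle.exp_two_pi, mul_one]
    rw [hw] at hg ⊢
    rw [gradient_mul_exp v h1 h2] at hg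
    rw [psi, ← hg, Real.arctan_tan h1 h2]

/-! ### The rotation number -/

/-- The projection `ℝ → ℝ/ℤ = S¹`. -/
def proj (x : ℝ) : Circle := Circle.exp (2 * Real.pi * x)

/-- `g` is the lift, with `g 0 ∈ [0, 1)`, of the orientation preserving homeomorphism `f` of the
circle: `g` is continuous, strictly increasing, satisfies `g (x + 1) = g x + 1`, and covers `f`.
(The maps of the circle that have such a lift are its orientation preserving homeomorphisms.) -/
structure IsNormalizedLift (f : Circle → Circle) (g : CircleDeg1Lift) : Prop where
  continuous : Continuous g
  strictMono : StrictMono g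
  semiconj : ∀ x, proj (g x) = f (proj x)
  map_zero_mem : g 0 ∈ Set.Ico (0 : ℝ) 1

open Classical in
/-- The rotation number `lim (gⁿ x - x) / n` of an orientation preserving homeomorphism `f` of the
circle, where `g` is the normalized lift of `f`. The value is `0` by convention if `f` is not an
orientation preserving homeomorphism. -/
def rotationNumber (f : Circle → Circle) : ℝ :=
  if h : ∃ g : CircleDeg1Lift, IsNormalizedLift f g then h.choose.translationNumber else 0

theorem proj_eq_iff {x y : ℝ} : proj x = proj y ↔ ∃ n : ℤ, x = y + n := by
  rw [proj, proj, Circle.exp_eq_exp]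
  have hpi := Real.pi_pos
  refine exists_congr fun n => ⟨fun h => ?_, fun h => by rw [h]; ring⟩
  have : (2 * Real.pi) * (x - (y + n)) = 0 := by linarith
  rcases mul_eq_zero.1 this with h | h <;> linarith

/-- The normalized lift is unique. -/
theorem IsNormalizedLift.unique {f : Circle → Circle} {g h : CircleDeg1Lift}
    (hg : IsNormalizedLift f g) (hh : IsNormalizedLift f h) : g = h := by
  have hint : ∀ x, ∃ n : ℤ, g x - h x = n := fun x => by
    obtain ⟨n, hn⟩ := proj_eq_iff.1 ((hg.semiconj x).trans (hh.semiconj x).symm)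
    exact ⟨n, by linarith⟩
  have h0 : g 0 - h 0 = 0 := by
    obtain ⟨n, hn⟩ := hint 0
    have a := hg.map_zero_mem
    have b := hh.map_zero_mem
    have h1 : (n : ℝ) < 1 := by rw [← hn]; linarith [a.2, b.1]
    have h2 : (-1 : ℝ) < n := by rw [← hn]; linarith [a.1, b.2]
    have : n = 0 := by
      have h1' : n < 1 := by exact_mod_cast h1
      have h2' : -1 < n := by exact_mod_cast h2
      omega
    rw [hn, this, Int.cast_zero]
  have hc : Continuous fun x => g x - h x := hg.continuous.sub hh.continuous
  have half : ∀ (c : ℝ), (∀ n : ℤ, c ≠ n) → ∀ y, g y - h y ≠ c := fun c hcn y hy => by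
    obtain ⟨n, hn⟩ := hint y
    exact hcn n (hy.symm.trans hn)
  have nothalf : ∀ n : ℤ, (1 / 2 : ℝ) ≠ n := fun n hn => by
    have : (1 : ℝ) = ((2 * n : ℤ) : ℝ) := by push_cast; linarith
    have : (1 : ℤ) = 2 * n := by exact_mod_cast this
    omega
  have nothalf' : ∀ n : ℤ, (-(1 / 2) : ℝ) ≠ n := fun n hn =>
    nothalf (-n) (by push_cast; linarith)
  ext x
  obtain ⟨n, hn⟩ := hint x
  rcases lt_trichotomy n 0 with hlt | heq | hgt
  · have : (n : ℝ) ≤ -1 := by exact_mod_cast (by omega : n ≤ -1)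
    obtain ⟨y, hy⟩ := mem_range_of_exists_le_of_exists_ge (c := -(1 / 2)) hc
      ⟨x, by simp only [hn]; linarith⟩ ⟨0, by simp only [h0]; norm_num⟩
    exact absurd hy (half _ nothalf' y)
  · rw [heq, Int.cast_zero] at hn
    linarith
  · have : (1 : ℝ) ≤ n := by exact_mod_cast (by omega : 1 ≤ n)
    obtain ⟨y, hy⟩ := mem_range_of_exists_le_of_exists_ge (c := 1 / 2) hc
      ⟨0, by simp only [h0]; norm_num⟩ ⟨x, by simp only [hn]; linarith⟩
    exact absurd hy (half _ nothalf y)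

theorem IsNormalizedLift.rotationNumber_eq {f : Circle → Circle} {g : CircleDeg1Lift}
    (hg : IsNormalizedLift f g) : rotationNumber f = g.translationNumber := by
  have h : ∃ g : CircleDeg1Lift, IsNormalizedLift f g := ⟨g, hg⟩
  rw [rotationNumber, dif_pos h, h.choose_spec.unique hg]

/-! ### Distances in the Beltrami–Klein model -/

/-- The end on the unit circle of the ray from `P` (a point of the disk) through `Q ≠ P`: the point
`P + s • (Q - P)`, with `s` the non-negative root of `‖P + s • (Q - P)‖ ^ 2 = 1`;
see `eq_rayEnd_iff`. -/
def rayEnd (P Q : ℂ) : ℂ :=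
  P + ((-inner ℝ P (Q - P) + √(inner ℝ P (Q - P) ^ 2 + ‖Q - P‖ ^ 2 * (1 - ‖P‖ ^ 2)))
    / ‖Q - P‖ ^ 2 : ℝ) • (Q - P)

theorem eq_rayEnd_iff {P Q v : ℂ} (hP : ‖P‖ < 1) (hPQ : P ≠ Q) :
    v = rayEnd P Q ↔ ‖v‖ = 1 ∧ ∃ s : ℝ, 0 ≤ s ∧ v = P + s • (Q - P) := by
  have hw : 0 < ‖Q - P‖ ^ 2 := by
    have := norm_pos_iff.2 (sub_ne_zero.2 hPQ.symm); positivity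
  have hc : 0 < 1 - ‖P‖ ^ 2 := by nlinarith [norm_nonneg P]
  have hn : ∀ s : ℝ, ‖P + s • (Q - P)‖ ^ 2
      = ‖P‖ ^ 2 + 2 * s * inner ℝ P (Q - P) + s ^ 2 * ‖Q - P‖ ^ 2 := fun s => by
    rw [norm_add_sq_real, inner_smul_right, norm_smul, mul_pow, Real.norm_eq_abs, sq_abs]; ring
  unfold rayEnd
  generalize inner ℝ P (Q - P) = b at *
  generalize hW : ‖Q - P‖ ^ 2 = W at *
  generalize hC : 1 - ‖P‖ ^ 2 = C at *
  have hr0 : 0 ≤ √(b ^ 2 + W * C) := Real.sqrt_nonneg _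
  have hr : √(b ^ 2 + W * C) ^ 2 = b ^ 2 + W * C := Real.sq_sqrt (by positivity)
  generalize √(b ^ 2 + W * C) = r at *
  have hWC : 0 < W * C := mul_pos hw hc
  have hbr : |b| < r := abs_lt_of_sq_lt_sq (by linarith) hr0
  have hbr' := abs_lt.1 hbr
  constructor
  · rintro rfl
    refine ⟨?_, (-b + r) / W, div_nonneg (by linarith) hw.le, rfl⟩
    have h2 : ‖P + ((-b + r) / W) • (Q - P)‖ ^ 2 = 1 := by
      rw [hn]; field_simp; nlinarith
    exact (pow_eq_one_iff_of_nonneg (norm_nonneg _) two_ne_zero).1 h2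
  · rintro ⟨h1, s, hs, rfl⟩
    have h2 := hn s
    rw [h1] at h2
    have h3 : (s * W + b - r) * (s * W + b + r) = 0 := by nlinarith
    have h4 : 0 < s * W + b + r := by nlinarith [mul_nonneg hs hw.le]
    have h5 : s * W + b - r = 0 := (mul_eq_zero.1 h3).resolve_right h4.ne'
    have h6 : s = (-b + r) / W := by rw [eq_div_iff hw.ne']; linarith
    rw [h6]

/-- The Beltrami–Klein distance `d'(P, Q) = ½ |log (|v₁Q| |v₂P| / (|v₁P| |v₂Q|))|`, where
`v₁ = rayEnd Q P` and `v₂ = rayEnd P Q` are the two points in which the line `PQ` meets the unit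
circle. For `P = Q` the value of the expression is `0`. -/
def dist' (P Q : ℂ) : ℝ :=
  1 / 2 * |Real.log (‖rayEnd Q P - Q‖ * ‖rayEnd P Q - P‖
    / (‖rayEnd Q P - P‖ * ‖rayEnd P Q - Q‖))|

theorem dist'_self (P : ℂ) : dist' P P = 0 := by simp [dist', rayEnd]

/-- `δ(P, Q, R)`: the least distance from `R` to a point of the hyperbolic line `PQ`. -/
def delta (P Q R : ℂ) : ℝ :=
  sInf {r : ℝ | ∃ S : ℂ, S ∈ line[ℝ, P, Q] ∧ ‖S‖ < 1 ∧ r = dist' R S}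

/-- `Δₙ'(P, Q) = log ((exp (n d'(P, Q)) + 1) / (exp (n d'(P, Q)) - 1))`. -/
def Delta' (n : ℕ) (P Q : ℂ) : ℝ :=
  Real.log ((Real.exp (n * dist' P Q) + 1) / (Real.exp (n * dist' P Q) - 1))

end

end BarBilliard

namespace BarBilliard

noncomputable section

/-! ### Hyperbolic distances through the polar form -/

/-! Each vertex gives the half-turn that swaps the ends of every chord through it. Its lift with
displacement in (0, 1) squares to translation by 1. The lift of ψ is the pointwise minimum of the
three lifts (`psiLift_isLeast`), so its fifth iterate at a point is the value there of some
five-letter word in them. Hence ρ > 2/5 once every such word moves every point by more than 2.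

Cancelling equal letters and rotating cyclically (`pointLift_five_gt`) leaves three-letter words and
words `ababc`. The latter move some point by more than 2, so by the intermediate value theorem they
always do, unless the underlying Möbius map fixes a point of the circle. `eigen_im_sq_ge` excludes
this by a trace bound.

With d = d'(a, b) and D the distance from c to the line ab, the trace bound for `ababc` reads sinh
2d · sinh D < 1. This is the hypothesis, which says e^D < coth d (`trace_sq_lt`). -/

/-- The polar form `1 - ⟨P, Q⟩` of the unit circle. -/
def polar (P Q : ℂ) : ℝ := 1 - (P.re * Q.re + P.im * Q.im)

/-- Twice the signed area of the triangle `a b c`. -/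
def signedArea (a b c : ℂ) : ℝ :=
  (b.re - a.re) * (c.im - a.im) - (b.im - a.im) * (c.re - a.re)

theorem polar_self (P : ℂ) : polar P P = 1 - ‖P‖ ^ 2 := by
  rw [polar, Complex.sq_norm, Complex.normSq_apply]

theorem polar_self_pos {P : ℂ} (hP : ‖P‖ < 1) : 0 < polar P P := by
  rw [polar_self]; nlinarith [norm_nonneg P]

/-- The polynomial form of cosh d' = polar P Q / √(polar P P · polar Q Q). Up to a common factor,
`X` and `Y` are the numerator and denominator of the cross-ratio, so hyperbolic functions of d'
become rational in them. -/
theorem exists_exp_dist' {P Q : ℂ} (hP : ‖P‖ < 1) (hQ : ‖Q‖ < 1) :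
    ∃ X Y : ℝ, 0 < Y ∧ Y ≤ X ∧ (P ≠ Q → Y < X) ∧ X * Y = polar P P * polar Q Q ∧
      X + Y = 2 * polar P Q ∧ Real.exp (2 * dist' P Q) = X / Y := by
  have hmP := polar_self_pos hP
  have hmQ := polar_self_pos hQ
  rcases eq_or_ne P Q with rfl | hne
  · refine ⟨polar P P, polar P P, hmP, le_rfl, fun h => absurd rfl h, rfl, by ring, ?_⟩
    rw [dist'_self, div_self hmP.ne']; simp
  obtain ⟨h1, s, hs, hv2⟩ := (eq_rayEnd_iff hP hne).1 rfl
  obtain ⟨h2, t, ht, hv1⟩ := (eq_rayEnd_iff hQ hne.symm).1 rfl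
  have hL : 0 < ‖P - Q‖ := norm_pos_iff.2 (sub_ne_zero.2 hne)
  set W : ℝ := (P.re - Q.re) ^ 2 + (P.im - Q.im) ^ 2 with hW
  have hWL : W = ‖P - Q‖ ^ 2 := by
    rw [Complex.sq_norm, Complex.normSq_apply]; simp only [Complex.sub_re, Complex.sub_im]; ring
  have hW0 : 0 < W := by rw [hWL]; positivity
  have e1 : ‖P + s • (Q - P)‖ ^ 2 = 1 := by rw [← hv2, h1]; norm_num
  have e2 : ‖Q + t • (P - Q)‖ ^ 2 = 1 := by rw [← hv1, h2]; norm_num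
  rw [Complex.sq_norm, Complex.normSq_apply] at e1 e2
  simp only [Complex.add_re, Complex.add_im, Complex.real_smul, Complex.mul_re, Complex.mul_im,
    Complex.ofReal_re, Complex.ofReal_im, Complex.sub_re, Complex.sub_im, zero_mul, sub_zero,
    add_zero] at e1 e2
  have f1 : polar P P * (1 - s) ^ 2 + 2 * polar P Q * (s * (1 - s)) + polar Q Q * s ^ 2 = 0 := by
    unfold polar; linear_combination -e1
  have f2 : polar P P * t ^ 2 + 2 * polar P Q * (t * (1 - t)) + polar Q Q * (1 - t) ^ 2 = 0 := by
    unfold polar; linear_combination -e2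
  have hWk : polar P P + polar Q Q - 2 * polar P Q = - W := by unfold polar; rw [hW]; ring
  have hk : 0 < polar P Q := by nlinarith
  have hs1 : 1 < s := by
    by_contra hc
    have h0 : 0 ≤ s * (1 - s) := mul_nonneg hs (by linarith)
    have h3 := mul_nonneg hk.le h0
    have h4 := mul_nonneg hmP.le (sq_nonneg (1 - s))
    have h5 := mul_nonneg hmQ.le (sq_nonneg s)
    have h6 : polar Q Q * s ^ 2 = 0 := by linarith
    have h7 : polar P P * (1 - s) ^ 2 = 0 := by linarith
    have h8 : s = 0 := by simpa [hmQ.ne'] using h6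
    rw [h8] at h7; linarith
  have ht1 : 1 < t := by
    by_contra hc
    have h0 : 0 ≤ t * (1 - t) := mul_nonneg ht (by linarith)
    have h3 := mul_nonneg hk.le h0
    have h4 := mul_nonneg hmP.le (sq_nonneg t)
    have h5 := mul_nonneg hmQ.le (sq_nonneg (1 - t))
    have h6 : polar P P * t ^ 2 = 0 := by linarith
    have h7 : polar Q Q * (1 - t) ^ 2 = 0 := by linarith
    have h8 : t = 0 := by simpa [hmP.ne'] using h6
    rw [h8] at h7; linarith
  -- In the affine coordinate on the line, the two ends are `s` and `1 - t`, the roots of a single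
  -- quadratic. This is Vieta's formula for their sum; the roots differ, so `s + t - 1` can be
  -- cancelled.
  have hsum : 2 * polar P Q - 2 * polar P P - W * (s + 1 - t) = 0 := by
    have : (2 * polar P Q - 2 * polar P P - W * (s + 1 - t)) * (s + t - 1) = 0 := by
      linear_combination f1 - f2 + (t ^ 2 - s ^ 2 - 2 * t + 1) * hWk
    exact (mul_eq_zero.1 this).resolve_right (by linarith)
  have gP : polar P P = W * (s * (t - 1)) := by
    linear_combination f1 - s ^ 2 * hWk - s * hsum
  have gQ : polar Q Q = W * (t * (s - 1)) := by linear_combination hWk + hsum + gP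
  have gPQ : 2 * polar P Q = W * (s * t) + W * ((s - 1) * (t - 1)) := by
    linear_combination hsum + 2 * gP
  have hs0 : 0 < s - 1 := by linarith
  have ht0 : 0 < t - 1 := by linarith
  have hlt : W * ((s - 1) * (t - 1)) < W * (s * t) :=
    mul_lt_mul_of_pos_left (by nlinarith) hW0
  refine ⟨W * (s * t), W * ((s - 1) * (t - 1)), by positivity, hlt.le, fun _ => hlt, ?_,
    gPQ.symm, ?_⟩
  · rw [gP, gQ]; ring
  have n1 : ‖rayEnd Q P - Q‖ = t * ‖P - Q‖ := by
    rw [hv1, add_sub_cancel_left, norm_smul, Real.norm_of_nonneg ht]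
  have n2 : ‖rayEnd P Q - P‖ = s * ‖P - Q‖ := by
    rw [hv2, add_sub_cancel_left, norm_smul, Real.norm_of_nonneg hs, norm_sub_rev]
  have n3 : ‖rayEnd Q P - P‖ = (t - 1) * ‖P - Q‖ := by
    rw [hv1, show Q + t • (P - Q) - P = (t - 1) • (P - Q) by
      simp only [Complex.real_smul]; push_cast; ring, norm_smul, Real.norm_of_nonneg ht0.le]
  have n4 : ‖rayEnd P Q - Q‖ = (s - 1) * ‖P - Q‖ := by
    rw [hv2, show P + s • (Q - P) - Q = (s - 1) • (Q - P) by
      simp only [Complex.real_smul]; push_cast; ring, norm_smul, Real.norm_of_nonneg hs0.le,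
      norm_sub_rev]
  have hr : t * ‖P - Q‖ * (s * ‖P - Q‖) / ((t - 1) * ‖P - Q‖ * ((s - 1) * ‖P - Q‖))
      = W * (s * t) / (W * ((s - 1) * (t - 1))) := by
    field_simp
  have h1r : 1 ≤ W * (s * t) / (W * ((s - 1) * (t - 1))) := by
    rw [one_le_div (by positivity)]; exact hlt.le
  rw [dist', n1, n2, n3, n4, hr, abs_of_nonneg (Real.log_nonneg h1r),
    ← mul_assoc, show (2 : ℝ) * (1 / 2) = 1 by norm_num, one_mul, Real.exp_log (by linarith)]

/-- The hyperbolic distance from `c` to a point `s` of the line `a b` is at least the distance from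
`c` to the line. -/
theorem signedArea_sq_mul_le {a b c s : ℂ} (hs : s ∈ line[ℝ, a, b]) :
    signedArea a b c ^ 2 * polar s s ≤
      (polar c s ^ 2 - polar c c * polar s s) * (polar a b ^ 2 - polar a a * polar b b) := by
  obtain ⟨t, rfl⟩ := mem_affineSpan_pair_iff_exists_lineMap_eq.1 hs
  simp only [AffineMap.lineMap_apply, vsub_eq_sub, vadd_eq_add, Complex.real_smul]
  set x := ((t : ℂ) * (b - a) + a) with hx
  have hre : x.re = t * (b.re - a.re) + a.re := by simp [hx]
  have him : x.im = t * (b.im - a.im) + a.im := by simp [hx]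
  rw [← sub_nonneg]
  -- The deficit is a perfect square on the line; it vanishes when `x` is the foot of the
  -- perpendicular from `c`.
  have : (polar c x ^ 2 - polar c c * polar x x) * (polar a b ^ 2 - polar a a * polar b b)
      - signedArea a b c ^ 2 * polar x x =
      (polar c x * (polar b x - polar a x) - (polar c b - polar c a) * polar x x) ^ 2 := by
    simp only [polar, signedArea, hre, him]; ring
  rw [this]; positivity

/-- Some `s` on the line has e^D < coth d, where D = d'(c, s) and d = d'(a, b). Hence 2 sinh D <
coth d - tanh d = 2 / sinh 2d. Moreover `signedArea_sq_mul_le` bounds the squared area by sinh² D ·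
sinh² d times the three norms `polar a a`, `polar b b`, `polar c c`. -/
theorem trace_sq_lt {a b c : ℂ} (ha : ‖a‖ < 1) (hb : ‖b‖ < 1) (hc : ‖c‖ < 1) (hab : a ≠ b)
    (h : Delta' 2 a b > delta a b c) :
    4 * polar a b ^ 2 * signedArea a b c ^ 2 < polar a a ^ 2 * polar b b ^ 2 * polar c c := by
  have hne : {r : ℝ | ∃ S : ℂ, S ∈ line[ℝ, a, b] ∧ ‖S‖ < 1 ∧ r = dist' c S}.Nonempty :=
    ⟨_, a, left_mem_affineSpan_pair ℝ a b, ha, rfl⟩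
  obtain ⟨_, ⟨s, hsl, hs, rfl⟩, hlt⟩ := exists_lt_of_csInf_lt hne h
  obtain ⟨X, Y, hY, -, hYX, hXY, hX2, hXe⟩ := exists_exp_dist' ha hb
  obtain ⟨Z, V, hV, hVZ, -, hZV, hZ2, hZe⟩ := exists_exp_dist' hc hs
  specialize hYX hab
  have hma := polar_self_pos ha
  have hmb := polar_self_pos hb
  have hmc := polar_self_pos hc
  have hms := polar_self_pos hs
  have hD : Delta' 2 a b = Real.log ((X + Y) / (X - Y)) := by
    rw [Delta']; push_cast; rw [hXe]; congr 1
    have : X - Y ≠ 0 := by linarith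
    field_simp
  have hXY0 : 0 < X - Y := by linarith
  rw [hD] at hlt
  have hE : Real.exp (dist' c s) < (X + Y) / (X - Y) := by
    rw [← Real.lt_log_iff_exp_lt (by apply div_pos <;> linarith)]; exact hlt
  have hE2 : Z / V < ((X + Y) / (X - Y)) ^ 2 := by
    rw [← hZe, two_mul, Real.exp_add, ← sq]
    exact pow_lt_pow_left₀ hE (Real.exp_pos _).le two_ne_zero
  rw [div_pow, div_lt_div_iff₀ hV (by positivity)] at hE2
  have hZ : 0 < Z := by linarith
  have hX : 0 < X := by linarith
  -- This is sinh² D · sinh² 2d < 1, as X/Y = e^(2d) and Z/V = e^(2D).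
  have key : (Z - V) ^ 2 * ((X + Y) ^ 2 * (X - Y) ^ 2) < 16 * (X * Y) ^ 2 * (Z * V) := by
    have e : 16 * (X * Y) ^ 2 * (Z * V) - (Z - V) ^ 2 * ((X + Y) ^ 2 * (X - Y) ^ 2)
        = ((X + Y) ^ 2 * V - Z * (X - Y) ^ 2) * (Z * (X + Y) ^ 2 - V * (X - Y) ^ 2) := by ring
    have p : 0 < Z * (X + Y) ^ 2 - V * (X - Y) ^ 2 := by
      have h1 : V * (X - Y) ^ 2 ≤ Z * (X - Y) ^ 2 :=
        mul_le_mul_of_nonneg_right hVZ (by positivity)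
      have h2 : Z * (X - Y) ^ 2 < Z * (X + Y) ^ 2 :=
        mul_lt_mul_of_pos_left (by nlinarith) hZ
      linarith
    have := mul_pos (sub_pos.2 hE2) p
    linarith
  have g1 : (Z - V) ^ 2 = 4 * (polar c s ^ 2 - polar c c * polar s s) := by
    rw [← hZV]; linear_combination (Z + V + 2 * polar c s) * hZ2
  have g2 : (X - Y) ^ 2 = 4 * (polar a b ^ 2 - polar a a * polar b b) := by
    rw [← hXY]; linear_combination (X + Y + 2 * polar a b) * hX2
  have hle := signedArea_sq_mul_le (c := c) hsl
  rw [g1, g2, hX2, hXY, hZV] at key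
  have hle' := mul_le_mul_of_nonneg_left hle (by positivity : 0 ≤ 64 * polar a b ^ 2)
  refine lt_of_mul_lt_mul_right ?_ hms.le
  linarith

/-- Since cosh d ≥ 1, the bound for `ababc` implies the one for `abc`. -/
theorem signedArea_sq_lt {a b c : ℂ} (ha : ‖a‖ < 1) (hb : ‖b‖ < 1)
    (h : 4 * polar a b ^ 2 * signedArea a b c ^ 2 < polar a a ^ 2 * polar b b ^ 2 * polar c c) :
    signedArea a b c ^ 2 < polar a a * polar b b * polar c c := by
  obtain ⟨X, Y, -, -, -, hXY, hX2, -⟩ := exists_exp_dist' ha hb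
  have h1 : polar a a * polar b b ≤ polar a b ^ 2 := by
    have h4 : (X + Y) ^ 2 = 4 * polar a b ^ 2 := by rw [hX2]; ring
    nlinarith [sq_nonneg (X - Y)]
  have h2 := mul_pos (polar_self_pos ha) (polar_self_pos hb)
  refine lt_of_mul_lt_mul_left ?_ h2.le
  nlinarith [mul_le_mul_of_nonneg_right h1 (sq_nonneg (signedArea a b c)),
    mul_nonneg h2.le (sq_nonneg (signedArea a b c))]

open ComplexConjugate

/-! ### The lift of the half-turn about a point of the disk -/

/-- The lift of the map of the circle that sends `v` to the second end of the chord through `v` and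
`u`. -/
def pointLift (u : ℂ) (x : ℝ) : ℝ := x + 1 / 2 + Real.arctan (gradient (proj x) u) / Real.pi

theorem proj_add_one (x : ℝ) : proj (x + 1) = proj x := proj_eq_iff.2 ⟨1, by simp⟩

theorem continuous_proj : Continuous proj := by unfold proj; fun_prop

theorem one_sub_conj_mul_ne_zero {u : ℂ} (hu : ‖u‖ < 1) (v : Circle) : 1 - conj u * v ≠ 0 := by
  intro h
  have h1 : ‖conj u * (v : ℂ)‖ = 1 := by rw [← sub_eq_zero.1 h, norm_one]
  rw [norm_mul, Complex.norm_conj, Circle.norm_coe, mul_one] at h1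
  exact hu.ne h1

theorem re_sub_div_neg {u : ℂ} (hu : ‖u‖ < 1) (v : Circle) : ((u - v) / v).re < 0 := by
  have hv : (v : ℂ) ≠ 0 := v.coe_ne_zero
  rw [sub_div, div_self hv, Complex.sub_re, Complex.one_re, sub_neg]
  calc (u / v).re ≤ ‖u / v‖ := Complex.re_le_norm _
    _ = ‖u‖ := by rw [norm_div, Circle.norm_coe, div_one]
    _ < 1 := hu

theorem proj_add_arctan (x a : ℝ) : proj (x + 1 / 2 + Real.arctan a / Real.pi)
    = proj x * Circle.exp (Real.pi + 2 * Real.arctan a) := by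
  rw [proj, proj, ← Circle.exp_add]
  congr 1
  field_simp
  ring

/-- With z = (u - v)/v, the exponential is -z / conj z, so the chord map is the Möbius map v ↦ (u -
v) / (1 - conj u · v). -/
theorem chord_eq {u : ℂ} (hu : ‖u‖ < 1) (v : Circle) :
    ((v * Circle.exp (Real.pi + 2 * Real.arctan (gradient v u)) : Circle) : ℂ) * (1 - conj u * v)
      = u - v := by
  have hv : (v : ℂ) ≠ 0 := v.coe_ne_zero
  have hn := re_sub_div_neg hu v
  have hvv : (v : ℂ) * conj (v : ℂ) = 1 := by
    rw [Complex.mul_conj, Circle.normSq_coe, Complex.ofReal_one]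
  set z : ℂ := (u - v) / v with hz
  have hzc : conj z = conj u * v - 1 := by
    rw [hz, map_div₀, map_sub, div_eq_iff (by simp)]
    linear_combination (-conj u) * hvv
  have huv : u - v = v * z := by rw [hz, mul_div_cancel₀ _ hv]
  have hexp : Complex.exp ((Real.pi + 2 * Real.arctan (gradient v u) : ℝ) * Complex.I) * conj z
      = - z := by
    set a := Real.arctan (gradient v u)
    have hc : Real.cos a ≠ 0 := (Real.cos_arctan_pos _).ne'
    have ht : Real.sin a * z.re = z.im * Real.cos a := by
      have : Real.tan a = z.im / z.re := Real.tan_arctan _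
      rw [Real.tan_eq_sin_div_cos, div_eq_div_iff hc hn.ne] at this
      exact this
    have hsc := Real.sin_sq_add_cos_sq a
    apply Complex.ext
    · rw [Complex.mul_re, Complex.exp_ofReal_mul_I_re, Complex.exp_ofReal_mul_I_im, 
        add_comm Real.pi, Real.cos_add_pi, Real.sin_add_pi, Real.sin_two_mul, Real.cos_two_mul, Complex.conj_re,
        Complex.conj_im, Complex.neg_re]
      linear_combination 2 * Real.sin a * ht - 2 * z.re * hsc
    · rw [Complex.mul_im, Complex.exp_ofReal_mul_I_re, Complex.exp_ofReal_mul_I_im, 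
        add_comm Real.pi, Real.cos_add_pi, Real.sin_add_pi, Real.sin_two_mul, Real.cos_two_mul, Complex.conj_re,
        Complex.conj_im, Complex.neg_im]
      linear_combination (-2) * Real.cos a * ht
  rw [Circle.coe_mul, Circle.coe_exp, huv]
  linear_combination (-(v : ℂ)) * hexp + (v : ℂ) * Complex.exp
    ((Real.pi + 2 * Real.arctan (gradient v u) : ℝ) * Complex.I) * hzc

theorem pointLift_chord {u : ℂ} (hu : ‖u‖ < 1) (x : ℝ) :
    (proj (pointLift u x) : ℂ) * (1 - conj u * proj x) = u - proj x := by
  rw [pointLift, proj_add_arctan]; exact chord_eq hu _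

theorem pointLift_add_one (u : ℂ) (x : ℝ) : pointLift u (x + 1) = pointLift u x + 1 := by
  simp only [pointLift, proj_add_one]; ring

theorem pointLift_mem (u : ℂ) (x : ℝ) : x < pointLift u x ∧ pointLift u x < x + 1 := by
  have hpi := Real.pi_pos
  have h1 := div_lt_div_of_pos_right (Real.arctan_lt_pi_div_two (gradient (proj x) u)) hpi
  have h2 := div_lt_div_of_pos_right (Real.neg_pi_div_two_lt_arctan (gradient (proj x) u)) hpi
  have e1 : Real.pi / 2 / Real.pi = 1 / 2 := by field_simp
  have e2 : -(Real.pi / 2) / Real.pi = -(1 / 2) := by field_simp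
  rw [e1] at h1
  rw [e2] at h2
  constructor <;> unfold pointLift <;> linarith

theorem continuous_pointLift {u : ℂ} (hu : ‖u‖ < 1) : Continuous (pointLift u) := by
  have hc : Continuous fun x : ℝ => ((u - (proj x : ℂ)) / proj x) :=
    (continuous_const.sub (continuous_induced_dom.comp continuous_proj)).div
      (continuous_induced_dom.comp continuous_proj) fun x => (proj x).coe_ne_zero
  have hg : Continuous fun x : ℝ => gradient (proj x) u :=
    (Complex.continuous_im.comp hc).div (Complex.continuous_re.comp hc)
      fun x => (re_sub_div_neg hu _).ne
  unfold pointLift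
  exact (by fun_prop : Continuous fun x : ℝ => x + 1 / 2).add
    ((Real.continuous_arctan.comp hg).div_const _)

theorem pointLift_pointLift {u : ℂ} (hu : ‖u‖ < 1) (x : ℝ) :
    pointLift u (pointLift u x) = x + 1 := by
  have h1 := pointLift_chord hu x
  have h2 := pointLift_chord hu (pointLift u x)
  have hp : proj (pointLift u (pointLift u x)) = proj x := by
    ext1
    apply mul_right_cancel₀ (one_sub_conj_mul_ne_zero hu (proj (pointLift u x)))
    linear_combination h2 - h1
  obtain ⟨n, hn⟩ := proj_eq_iff.1 hp
  have m1 := pointLift_mem u x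
  have m2 := pointLift_mem u (pointLift u x)
  have l1 : (0 : ℝ) < n := by linarith
  have l2 : (n : ℝ) < 2 := by linarith
  have : n = 1 := by
    have l1' : 0 < n := by exact_mod_cast l1
    have l2' : n < 2 := by exact_mod_cast l2
    omega
  rw [hn, this, Int.cast_one]

theorem strictMono_pointLift {u : ℂ} (hu : ‖u‖ < 1) : StrictMono (pointLift u) := by
  have hinj : Function.Injective (pointLift u) := fun x y hxy => by
    have := congrArg (pointLift u) hxy
    rw [pointLift_pointLift hu, pointLift_pointLift hu] at this
    linarith
  refine ((continuous_pointLift hu).strictMono_of_inj hinj).resolve_right fun h => ?_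
  have := h (lt_add_one (0 : ℝ))
  rw [pointLift_add_one] at this
  linarith

/-! ### Compositions of half-turns without fixed points -/

/-- The matrix of the half-turn about `u`. -/
def halfTurn (u : ℂ) : Matrix (Fin 2) (Fin 2) ℂ := !![-1, u; -conj u, 1]

theorem halfTurn_mulVec {u : ℂ} (hu : ‖u‖ < 1) (x : ℝ) :
    ∃ r : ℂ, Matrix.mulVec (halfTurn u) ![(proj x : ℂ), 1]
      = r • ![(proj (pointLift u x) : ℂ), 1] := by
  refine ⟨1 - conj u * proj x, ?_⟩
  have := pointLift_chord hu x
  ext i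
  fin_cases i
  · simp [halfTurn, Matrix.mulVec, dotProduct, Fin.sum_univ_two]
    linear_combination -this
  · simp [halfTurn, Matrix.mulVec, dotProduct, Fin.sum_univ_two]
    ring

theorem mulVec_mul_smul {A B : Matrix (Fin 2) (Fin 2) ℂ} {v w z : Fin 2 → ℂ} {r s : ℂ}
    (hB : Matrix.mulVec B v = r • w) (hA : Matrix.mulVec A w = s • z) :
    Matrix.mulVec (A * B) v = (r * s) • z := by
  rw [← Matrix.mulVec_mulVec, hB, Matrix.mulVec_smul, hA, smul_smul]

/-- Odd products of `halfTurn` matrices have this shape. Eliminating `r` from the two rows gives Re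
α = -Re(β · conj v), so (Re α)² ≤ |β|². Since the trace is 2i · Im α, a fixed point on the circle
rules out ellipticity. -/
theorem eigen_im_sq_ge {α β r : ℂ} (v : Circle) {M : Matrix (Fin 2) (Fin 2) ℂ}
    (hM : M = !![α, β; -conj β, -conj α])
    (h : Matrix.mulVec M ![(v : ℂ), 1] = r • ![(v : ℂ), 1]) :
    Complex.normSq α - Complex.normSq β ≤ α.im ^ 2 := by
  have h0 := congrFun h 0
  have h1 := congrFun h 1
  subst hM
  simp [Matrix.mulVec, dotProduct, Fin.sum_univ_two] at h0 h1
  have hvv : conj (v : ℂ) * (v : ℂ) = 1 := by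
    rw [mul_comm, Complex.mul_conj, Circle.normSq_coe, Complex.ofReal_one]
  have key : α + conj α + β * conj (v : ℂ) + conj β * v = 0 := by
    linear_combination conj (v : ℂ) * h0 - conj (v : ℂ) * v * h1
      - (α + r * 0 + conj β * v + conj α) * hvv
  have kre := congrArg Complex.re key
  simp at kre
  have hn : (v : ℂ).re ^ 2 + (v : ℂ).im ^ 2 = 1 := by
    have := Circle.normSq_coe v
    rw [Complex.normSq_apply] at this
    linarith
  rw [Complex.normSq_apply, Complex.normSq_apply]
  have e : α.re * α.re + (β.re * (v : ℂ).im - β.im * (v : ℂ).re) ^ 2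
      = β.re * β.re + β.im * β.im := by
    linear_combination (α.re - (β.re * (v : ℂ).re + β.im * (v : ℂ).im)) / 2 * kre
      + (β.re ^ 2 + β.im ^ 2) * hn
  linarith [sq_nonneg (β.re * (v : ℂ).im - β.im * (v : ℂ).re)]

theorem pointLift_three_ne {a b c : ℂ} (ha : ‖a‖ < 1) (hb : ‖b‖ < 1) (hc : ‖c‖ < 1)
    (h : signedArea a b c ^ 2 < polar a a * polar b b * polar c c) (x : ℝ) :
    pointLift a (pointLift b (pointLift c x)) ≠ x + 1 := by
  intro hx
  obtain ⟨r1, h1⟩ := halfTurn_mulVec hc x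
  obtain ⟨r2, h2⟩ := halfTurn_mulVec hb (pointLift c x)
  obtain ⟨r3, h3⟩ := halfTurn_mulVec ha (pointLift b (pointLift c x))
  rw [hx, proj_add_one] at h3
  have hM := mulVec_mul_smul (mulVec_mul_smul h1 h2) h3
  have := eigen_im_sq_ge (α := -1 + a * conj b - a * conj c + b * conj c)
    (β := c - a * conj b * c + a - b) (proj x) (by
      simp only [halfTurn, Matrix.mul_fin_two]
      ext i j
      fin_cases i <;> fin_cases j <;> simp <;> ring) hM
  refine absurd h (not_lt.2 (le_trans (le_of_eq ?_) (this.trans (le_of_eq ?_))))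
  · simp [Complex.normSq_apply, polar]; ring
  · simp [signedArea]; ring

theorem pointLift_five_ne {a b c : ℂ} (ha : ‖a‖ < 1) (hb : ‖b‖ < 1) (hc : ‖c‖ < 1)
    (h : 4 * polar a b ^ 2 * signedArea a b c ^ 2 < polar a a ^ 2 * polar b b ^ 2 * polar c c)
    (x : ℝ) :
    pointLift a (pointLift b (pointLift a (pointLift b (pointLift c x)))) ≠ x + 2 := by
  intro hx
  obtain ⟨r1, h1⟩ := halfTurn_mulVec hc x
  obtain ⟨r2, h2⟩ := halfTurn_mulVec hb (pointLift c x)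
  obtain ⟨r3, h3⟩ := halfTurn_mulVec ha (pointLift b (pointLift c x))
  obtain ⟨r4, h4⟩ := halfTurn_mulVec hb (pointLift a (pointLift b (pointLift c x)))
  obtain ⟨r5, h5⟩ := halfTurn_mulVec ha (pointLift b (pointLift a (pointLift b (pointLift c x))))
  rw [hx, show x + 2 = x + 1 + 1 by ring, proj_add_one, proj_add_one] at h5
  have hM := mulVec_mul_smul (mulVec_mul_smul (mulVec_mul_smul (mulVec_mul_smul h1 h2) h3) h4) h5
  -- `t` and `d` are the trace and determinant of N = `halfTurn a * halfTurn b`. By Cayley–Hamilton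
  -- N² = tN - d, so the entries reduce to those of the three-letter product. Both are real, so Im α
  -- is just multiplied by t = 2 `polar a b`.
  set t : ℂ := 2 - a * conj b - conj a * b with ht
  set d : ℂ := (1 - a * conj a) * (1 - b * conj b) with hd
  have := eigen_im_sq_ge (α := t * (-1 + a * conj b - a * conj c + b * conj c) + d)
    (β := t * (c - a * conj b * c + a - b) - d * c) (proj x) (by
      simp only [halfTurn, Matrix.mul_fin_two]
      ext i j
      fin_cases i <;> fin_cases j <;> simp [ht, hd, map_ofNat] <;> ring) hM
  refine absurd h (not_lt.2 (le_trans (le_of_eq ?_) (this.trans (le_of_eq ?_))))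
  · simp [Complex.normSq_apply, polar, ht, hd]; ring
  · simp [signedArea, polar, ht, hd]; ring

/-! ### Displacement of words in the half-turns -/

/-- If one lift were everywhere below the other, so would be its square, but both squares are
translation by 1. Geometrically, `y` lies over an end of the chord through `a` and `b`. -/
theorem exists_pointLift_eq {a b : ℂ} (ha : ‖a‖ < 1) (hb : ‖b‖ < 1) :
    ∃ y, pointLift a y = pointLift b y := by
  have key : ∀ {a b : ℂ}, ‖a‖ < 1 → ‖b‖ < 1 → ∃ y, pointLift b y ≤ pointLift a y := by
    intro a b ha hb
    by_contra! hc
    have h1 := strictMono_pointLift ha (hc 0)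
    have h2 := hc (pointLift b 0)
    rw [pointLift_pointLift ha] at h1
    rw [pointLift_pointLift hb] at h2
    linarith
  obtain ⟨y, hy⟩ := key ha hb
  obtain ⟨z, hz⟩ := key hb ha
  exact intermediate_value_univ₂ (continuous_pointLift ha) (continuous_pointLift hb) hz hy

theorem add_lt_of_ne {f : ℝ → ℝ} (hf : Continuous f) {m : ℝ} (hne : ∀ x, f x ≠ x + m)
    (hex : ∃ x, x + m < f x) (x : ℝ) : x + m < f x := by
  by_contra! h
  obtain ⟨y, hy⟩ := hex
  obtain ⟨z, hz⟩ := intermediate_value_univ₂ hf (by fun_prop : Continuous fun x : ℝ => x + m) h hy.le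
  exact hne z hz

theorem pointLift_sub_one (u : ℂ) (x : ℝ) : pointLift u (x - 1) = pointLift u x - 1 := by
  have := pointLift_add_one u (x - 1)
  rw [sub_add_cancel] at this
  linarith

theorem pointLift_three_gt_of_area {a b c : ℂ} (ha : ‖a‖ < 1) (hb : ‖b‖ < 1) (hc : ‖c‖ < 1)
    (h : signedArea a b c ^ 2 < polar a a * polar b b * polar c c) (x : ℝ) :
    x + 1 < pointLift a (pointLift b (pointLift c x)) := by
  refine add_lt_of_ne (f := fun x => pointLift a (pointLift b (pointLift c x)))
    ((continuous_pointLift ha).comp ((continuous_pointLift hb).comp (continuous_pointLift hc)))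
    (pointLift_three_ne ha hb hc h) ?_ x
  obtain ⟨y, hy⟩ := exists_pointLift_eq ha hb
  -- This point is chosen so that `c` sends it to `y`, where `a` and `b` agree; the remaining
  -- letters then act as translation by 1.
  refine ⟨pointLift c y - 1, ?_⟩
  simp only [pointLift_sub_one, pointLift_pointLift hc, add_sub_cancel_right, ← hy,
    pointLift_pointLift ha]
  linarith [(pointLift_mem c y).2]

theorem pointLift_five_gt_of_area {a b c : ℂ} (ha : ‖a‖ < 1) (hb : ‖b‖ < 1) (hc : ‖c‖ < 1)
    (h : 4 * polar a b ^ 2 * signedArea a b c ^ 2 < polar a a ^ 2 * polar b b ^ 2 * polar c c)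
    (x : ℝ) :
    x + 2 < pointLift a (pointLift b (pointLift a (pointLift b (pointLift c x)))) := by
  have hca := continuous_pointLift ha
  have hcb := continuous_pointLift hb
  refine add_lt_of_ne
    (f := fun x => pointLift a (pointLift b (pointLift a (pointLift b (pointLift c x)))))
    (hca.comp (hcb.comp (hca.comp (hcb.comp (continuous_pointLift hc)))))
    (pointLift_five_ne ha hb hc h) ?_ x
  obtain ⟨y, hy⟩ := exists_pointLift_eq ha hb
  refine ⟨pointLift c y - 1, ?_⟩
  simp only [pointLift_sub_one, pointLift_pointLift hc, add_sub_cancel_right, ← hy,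
    pointLift_pointLift ha, pointLift_add_one]
  linarith [(pointLift_mem c y).2]

variable {P : Fin 3 → ℂ}

theorem pointLift_three_gt (hD : ∀ i, ‖P i‖ < 1)
    (h : ∀ i j k : Fin 3, i ≠ j → i ≠ k → j ≠ k → ∀ x,
      x + 1 < pointLift (P i) (pointLift (P j) (pointLift (P k) x))) (i j k : Fin 3) (x : ℝ) :
    x + 1 < pointLift (P i) (pointLift (P j) (pointLift (P k) x)) := by
  by_cases hij : i = j
  · subst hij
    rw [pointLift_pointLift (hD i)]
    linarith [(pointLift_mem (P k) x).1]
  by_cases hjk : j = k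
  · subst hjk
    rw [pointLift_pointLift (hD j), pointLift_add_one]
    linarith [(pointLift_mem (P i) x).1]
  by_cases hik : i = k
  · subst hik
    rw [← pointLift_pointLift (hD i) x]
    exact strictMono_pointLift (hD i) (pointLift_mem _ _).1
  exact h i j k hij hik hjk x

theorem pointLift_add_two (u : ℂ) (x : ℝ) : pointLift u (x + 2) = pointLift u x + 2 := by
  rw [show x + 2 = x + 1 + 1 by ring, pointLift_add_one, pointLift_add_one]; ring

/-- Conjugation by `pointLift u`, whose inverse is itself minus 1: moving the last letter to the
front preserves the displacement bound. -/
theorem word_rotate {u : ℂ} (hu : ‖u‖ < 1) {f : ℝ → ℝ} (h : ∀ x, x + 2 < f (pointLift u x))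
    (x : ℝ) : x + 2 < pointLift u (f x) := by
  have h1 := strictMono_pointLift hu (h (pointLift u (x - 1)))
  rw [pointLift_pointLift hu, sub_add_cancel, pointLift_add_two, pointLift_pointLift hu] at h1
  linarith

theorem pointLift_five_gt (hD : ∀ i, ‖P i‖ < 1)
    (h3 : ∀ i j k : Fin 3, ∀ x,
      x + 1 < pointLift (P i) (pointLift (P j) (pointLift (P k) x)))
    (h5 : ∀ i j k : Fin 3, i ≠ j → i ≠ k → j ≠ k → ∀ x, x + 2 <
      pointLift (P i) (pointLift (P j) (pointLift (P i) (pointLift (P j) (pointLift (P k) x)))))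
    (i j k l m : Fin 3) (x : ℝ) : x + 2 <
      pointLift (P i) (pointLift (P j) (pointLift (P k) (pointLift (P l) (pointLift (P m) x)))) := by
  have hm := fun i => strictMono_pointLift (hD i)
  by_cases hij : i = j
  · subst hij
    rw [pointLift_pointLift (hD i)]
    linarith [h3 k l m x]
  by_cases hjk : j = k
  · subst hjk
    rw [pointLift_pointLift (hD j), pointLift_add_one]
    linarith [h3 i l m x]
  by_cases hkl : k = l
  · subst hkl
    rw [pointLift_pointLift (hD k), pointLift_add_one, pointLift_add_one]
    linarith [h3 i j m x]
  by_cases hlm : l = m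
  · subst hlm
    rw [pointLift_pointLift (hD l), pointLift_add_one, pointLift_add_one, pointLift_add_one]
    linarith [h3 i j k x]
  by_cases hmi : m = i
  · subst hmi
    have := hm m (h3 j k l (pointLift (P m) x))
    rw [pointLift_add_one, pointLift_pointLift (hD m)] at this
    linarith
  -- A word with no two cyclically adjacent letters equal is a proper 3-colouring of the 5-cycle.
  -- Its colour classes have sizes 2, 2, 1, so rotating the single letter to the end gives `ababc`.
  have comb : ∀ i j k l m : Fin 3, i ≠ j → j ≠ k → k ≠ l → l ≠ m → m ≠ i →
      (i = k ∧ j = l ∧ i ≠ m ∧ j ≠ m) ∨ (j = l ∧ k = m ∧ j ≠ i ∧ k ≠ i) ∨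
      (k = m ∧ l = i ∧ k ≠ j ∧ l ≠ j) ∨ (l = i ∧ m = j ∧ l ≠ k ∧ m ≠ k) ∨
      (m = j ∧ i = k ∧ m ≠ l ∧ i ≠ l) := by decide
  have key := comb i j k l m hij hjk hkl hlm hmi
  rcases key with ⟨rfl, rfl, h1, h2⟩ | ⟨rfl, rfl, h1, h2⟩ | ⟨rfl, rfl, h1, h2⟩ |
    ⟨rfl, rfl, h1, h2⟩ | ⟨rfl, rfl, h1, h2⟩
  · exact h5 i j m hij h1 h2 x
  · exact word_rotate (hD i) (f := fun x => pointLift (P j) (pointLift (P k)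
      (pointLift (P j) (pointLift (P k) x)))) (h5 j k i hjk h1 h2) x
  · refine word_rotate (hD _) (f := fun x => pointLift (P j) (pointLift (P k)
      (pointLift (P l) (pointLift (P k) x)))) ?_ x
    exact word_rotate (hD _) (f := fun x => pointLift (P k) (pointLift (P l)
      (pointLift (P k) (pointLift (P l) x)))) (h5 k l j hkl h1 h2)
  · refine word_rotate (hD _) (f := fun x => pointLift (P m) (pointLift (P k)
      (pointLift (P l) (pointLift (P m) x)))) ?_ x
    refine word_rotate (hD _) (f := fun x => pointLift (P k) (pointLift (P l)
      (pointLift (P m) (pointLift (P l) x)))) ?_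
    exact word_rotate (hD _) (f := fun x => pointLift (P l) (pointLift (P m)
      (pointLift (P l) (pointLift (P m) x)))) (h5 l m k hlm h1 h2)
  · refine word_rotate (hD _) (f := fun x => pointLift (P m) (pointLift (P i)
      (pointLift (P l) (pointLift (P m) x)))) ?_ x
    refine word_rotate (hD _) (f := fun x => pointLift (P i) (pointLift (P l)
      (pointLift (P m) (pointLift (P i) x)))) ?_
    refine word_rotate (hD _) (f := fun x => pointLift (P l) (pointLift (P m)
      (pointLift (P i) (pointLift (P m) x)))) ?_
    exact word_rotate (hD _) (f := fun x => pointLift (P m) (pointLift (P i)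
      (pointLift (P m) (pointLift (P i) x)))) (h5 m i l hmi h1 h2)

/-! ### The circle map of a triangle -/

theorem minGradient_convexHull {U : Set ℂ} {v : Circle} {g : ℂ} (hU : ∀ u ∈ U, ‖u‖ < 1)
    (hg : g ∈ U) (hmin : ∀ u ∈ U, gradient v g ≤ gradient v u) :
    minGradient (convexHull ℝ U) v = gradient v g := by
  refine IsLeast.csInf_eq ⟨⟨g, subset_convexHull ℝ U hg, rfl⟩, ?_⟩
  rintro _ ⟨u, hu, rfl⟩
  have hball : convexHull ℝ U ⊆ Metric.ball 0 1 :=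
    convexHull_min (fun u hu => by simpa using hU u hu) (convex_ball 0 1)
  have h1 : ‖u‖ < 1 := by simpa using hball hu
  set m := gradient v g
  set L : ℂ → ℝ := fun u => ((u / v).im - m * (u / v).re) with hL
  have hlin : IsLinearMap ℝ L := by
    constructor
    · intro x y; simp only [hL, add_div, Complex.add_im, Complex.add_re]; ring
    · intro c x
      simp only [hL, smul_div_assoc, Complex.smul_im, Complex.smul_re, smul_eq_mul]; ring
  -- The denominator of the gradient is negative on the disk, so a lower bound on the gradient cuts
  -- out a half-plane there; it passes from the vertices to their hull.
  have hiff : ∀ u : ℂ, ‖u‖ < 1 → (m ≤ gradient v u ↔ L u ≤ -m) := by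
    intro u hu
    rw [gradient, le_div_iff_of_neg (re_sub_div_neg hu v), sub_div, div_self v.coe_ne_zero]
    simp only [hL, Complex.sub_im, Complex.sub_re, Complex.one_re, Complex.one_im]
    constructor <;> intro h <;> linarith
  have hsub : convexHull ℝ U ⊆ {u | L u ≤ -m} :=
    convexHull_min (fun u hu => (hiff u (hU u hu)).1 (hmin u hu)) (convex_halfSpace_le hlin _)
  exact (hiff u h1).2 (hsub hu)

/-- The lift of the circle map of a set. -/
def psiLift (U : Set ℂ) (x : ℝ) : ℝ :=
  x + 1 / 2 + Real.arctan (minGradient U (proj x)) / Real.pi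

theorem psiLift_add_one (U : Set ℂ) (x : ℝ) : psiLift U (x + 1) = psiLift U x + 1 := by
  simp only [psiLift, proj_add_one]; ring

theorem proj_psiLift (U : Set ℂ) (x : ℝ) : proj (psiLift U x) = psi U (proj x) :=
  proj_add_arctan _ _

/-- The least gradient over the hull is attained at a vertex, and arctan is increasing. -/
theorem psiLift_isLeast (hD : ∀ i, ‖P i‖ < 1) (x : ℝ) :
    IsLeast (Set.range fun i => pointLift (P i) x) (psiLift (convexHull ℝ (Set.range P)) x) := by
  obtain ⟨i, hi⟩ := Finite.exists_min fun i => gradient (proj x) (P i)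
  have he : minGradient (convexHull ℝ (Set.range P)) (proj x) = gradient (proj x) (P i) :=
    minGradient_convexHull (by rintro _ ⟨j, rfl⟩; exact hD j) ⟨i, rfl⟩
      (by rintro _ ⟨j, rfl⟩; exact hi j)
  rw [psiLift, he]
  refine ⟨⟨i, rfl⟩, ?_⟩
  rintro _ ⟨j, rfl⟩
  have := div_le_div_of_nonneg_right (Real.arctan_strictMono.monotone (hi j)) Real.pi_pos.le
  simp only [pointLift]
  linarith

theorem strictMono_psiLift (hD : ∀ i, ‖P i‖ < 1) :
    StrictMono (psiLift (convexHull ℝ (Set.range P))) := by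
  intro x y hxy
  obtain ⟨i, hi⟩ := (psiLift_isLeast hD y).1
  rw [← hi]
  exact ((psiLift_isLeast hD x).2 ⟨i, rfl⟩).trans_lt (strictMono_pointLift (hD i) hxy)

theorem continuous_psiLift (hD : ∀ i, ‖P i‖ < 1) :
    Continuous (psiLift (convexHull ℝ (Set.range P))) := by
  have : psiLift (convexHull ℝ (Set.range P)) =
      fun x => Finset.univ.inf' Finset.univ_nonempty fun i => pointLift (P i) x := by
    funext x
    refine (psiLift_isLeast hD x).unique ⟨?_, ?_⟩
    · obtain ⟨i, -, hi⟩ := Finset.exists_mem_eq_inf' Finset.univ_nonempty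
        fun i => pointLift (P i) x
      exact ⟨i, hi.symm⟩
    · rintro _ ⟨j, rfl⟩
      exact Finset.inf'_le _ (Finset.mem_univ j)
  rw [this]
  exact Continuous.finset_inf'_apply _ fun i _ => continuous_pointLift (hD i)

/-- The circle map of a triangle is an orientation preserving homeomorphism. -/
theorem exists_isNormalizedLift (hD : ∀ i, ‖P i‖ < 1) :
    ∃ g : CircleDeg1Lift, IsNormalizedLift (psi (convexHull ℝ (Set.range P))) g ∧
      ∀ x, g x = psiLift (convexHull ℝ (Set.range P)) x := by
  refine ⟨⟨⟨psiLift (convexHull ℝ (Set.range P)), (strictMono_psiLift hD).monotone⟩,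
    psiLift_add_one _⟩, ⟨continuous_psiLift hD, strictMono_psiLift hD, proj_psiLift _, ?_⟩,
    fun _ => rfl⟩
  obtain ⟨i, hi⟩ := (psiLift_isLeast hD 0).1
  have := pointLift_mem (P i) 0
  change psiLift (convexHull ℝ (Set.range P)) 0 ∈ _
  rw [← hi]
  exact ⟨this.1.le, by linarith [this.2]⟩

end

end BarBilliard

theorem theorem5p3 (P : Fin 3 → ℂ) (hD : ∀ i, ‖P i‖ < 1) (hP : AffineIndependent ℝ P)
    (h : ∀ i j k : Fin 3, i ≠ j → i ≠ k → j ≠ k →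
      BarBilliard.Delta' 2 (P i) (P j) > BarBilliard.delta (P i) (P j) (P k)) :
    BarBilliard.rotationNumber (BarBilliard.psi (convexHull ℝ (Set.range P))) > 2 / 5 := by
  open BarBilliard in
  obtain ⟨g, hg, hgx⟩ := exists_isNormalizedLift hD
  rw [hg.rotationNumber_eq]
  have ht := fun i j k hij hik hjk =>
    trace_sq_lt (hD i) (hD j) (hD k) (hP.injective.ne hij) (h i j k hij hik hjk)
  have h3 := pointLift_three_gt hD fun i j k hij hik hjk =>
    pointLift_three_gt_of_area (hD i) (hD j) (hD k)
      (signedArea_sq_lt (hD i) (hD j) (ht i j k hij hik hjk))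
  have h5 := pointLift_five_gt hD h3 fun i j k hij hik hjk =>
    pointLift_five_gt_of_area (hD i) (hD j) (hD k) (ht i j k hij hik hjk)
  have step : ∀ y, ∃ i, g y = pointLift (P i) y := fun y => by
    obtain ⟨i, hi⟩ := (psiLift_isLeast hD y).1
    exact ⟨i, by rw [hgx, ← hi]⟩
  -- The minimising vertex may change at each iteration and with `x`, which is why `h5` covers all
  -- words. Continuity keeps the inequality strict for the translation number.
  have hlt : 2 < (g ^ 5).translationNumber := by
    refine CircleDeg1Lift.lt_translationNumber_of_forall_add_lt _ ?_ fun x => ?_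
    · rw [CircleDeg1Lift.coe_pow]; exact hg.continuous.iterate 5
    · rw [CircleDeg1Lift.coe_pow]
      change x + 2 < g (g (g (g (g x))))
      obtain ⟨m, hm⟩ := step x
      obtain ⟨l, hl⟩ := step (pointLift (P m) x)
      obtain ⟨k, hk⟩ := step (pointLift (P l) (pointLift (P m) x))
      obtain ⟨j, hj⟩ := step (pointLift (P k) (pointLift (P l) (pointLift (P m) x)))
      obtain ⟨i, hi⟩ := step (pointLift (P j) (pointLift (P k) (pointLift (P l)
        (pointLift (P m) x))))
      rw [hm, hl, hk, hj, hi]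
      exact h5 i j k l m x
  rw [CircleDeg1Lift.translationNumber_pow] at hlt
  push_cast at hlt
  linarith
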